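/- Let $p,q\in[0,1]$ and let $(X_n)_{n\ge 0}$ be the elephant random walk with memory parameter $p$ and first-step parameter $q$: $X_0=0$, $X_n=\sum_{k=1}^n\eta_k$, where $\eta_1=1$ with probability $q$ and $\eta_1=-1$ with probability $1-q$, and, for every $n\ge 1$, a time $n'$ is chosen uniformly from $\{1,\dots,n\}$ and $\eta_{n+1}=\eta_{n'}$ with probability $p$, $\eta_{n+1}=-\eta_{n'}$ with probability $1-p$, the two choices made at time $n+1$ being independent of each other and, jointly, of $(\eta_1,\dots,\eta_n)$. (a) If $p<3/4$, then $$\frac{X_n-\frac{2q-1}{\Gamma(2p)}\,n^{2p-1}}{\sqrt{\frac{n}{3-4p}}}\xrightarrow{\ \mathcal D\ }\mathcal N(0,1)\qquad(n\to\infty),$$ where $1/\Gamma(0)$ is read as $0$ when $p=0$. (b) If $p=3/4$, then $$\frac{X_n-\frac{2q-1}{\Gamma(3/2)}\,n^{1/2}}{\sqrt{n\ln n}}\xrightarrow{\ \mathcal D\ }\mathcal N(0,1)\qquad(n\to\infty).$$ -/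

import Mathlib

open MeasureTheory ProbabilityTheory Filter

/-- `X` is an elephant random walk on `ℤ` started at `0`, with memory parameter `p` and
first-step parameter `q`, driven by the increments `η n` (`n ≥ 1`), the remembered times
`m n` and the copy-or-flip signs `ε n` (`n ≥ 2`). -/
structure IsElephantRandomWalk {Ω : Type*} [MeasurableSpace Ω] (μ : Measure Ω) (p q : ℝ)
    (X η : ℕ → Ω → ℤ) (m : ℕ → Ω → ℕ) (ε : ℕ → Ω → ℤ) : Prop where
  measurable_increment : ∀ n, 1 ≤ n → Measurable (η n)
  measurable_time : ∀ n, 1 ≤ n → Measurable (m (n + 1))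
  measurable_sign : ∀ n, 1 ≤ n → Measurable (ε (n + 1))
  /-- the walk starts at the origin -/
  walk_zero : ∀ ω, X 0 ω = 0
  walk_succ : ∀ n ω, X (n + 1) ω = X n ω + η (n + 1) ω
  /-- the first step is `1` with probability `q` and `-1` with probability `1 - q` -/
  first_right : μ.real {ω | η 1 ω = 1} = q
  first_left : μ.real {ω | η 1 ω = -1} = 1 - q
  /-- the remembered time is uniform on `{1, …, n}` -/
  time_uniform : ∀ n, 1 ≤ n → ∀ k ∈ Finset.Icc 1 n,
    μ.real {ω | m (n + 1) ω = k} = 1 / (n : ℝ)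
  /-- the remembered step is copied with probability `p` and reversed with
  probability `1 - p` -/
  sign_copy : ∀ n, 1 ≤ n → μ.real {ω | ε (n + 1) ω = 1} = p
  sign_flip : ∀ n, 1 ≤ n → μ.real {ω | ε (n + 1) ω = -1} = 1 - p
  /-- the two choices at time `n + 1` are independent of each other ... -/
  indep_time_sign : ∀ n, 1 ≤ n → IndepFun (m (n + 1)) (ε (n + 1)) μ
  /-- ... and, jointly, of the past increments `η 1, …, η n` -/
  indep_past : ∀ n, 1 ≤ n →
    IndepFun (fun ω => (m (n + 1) ω, ε (n + 1) ω))
      (fun ω (k : Finset.Icc 1 n) => η (k : ℕ) ω) μ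
  increment_succ : ∀ n, 1 ≤ n →
    ∀ᵐ ω ∂μ, η (n + 1) ω = ε (n + 1) ω * η (m (n + 1) ω) ω

/-!
Write `α = 2 * p - 1`. Given the past, the next increment of the walk is `±1` with mean
`α * X n / n`. Hence passing from `X n` to `X (n + 1)` multiplies the conditional mean by
`1 + α / n` and adds a centred variable of conditional variance `1 - (α * X n / n) ^ 2`, which is
close to `1` because `E [(X n) ^ 2] ≤ n * (1 + log n)` for `p ≤ 3 / 4`. In terms of the
characteristic function `φ n` of `X n` this says (`norm_charFun_walk_succ_sub_le`)
`φ (n + 1) c ≈ exp (-c ^ 2 * d / 2) * φ n ((1 + α / n) * c)` with an error of smaller order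
than `c ^ 2` as `c → 0`, `n → ∞` and `d → 1`.

Let `w` be eventually positive with `d k := w (k + 1) - (1 + α / k) ^ 2 * w k → 1`. Start from
the frequency `c = t / √(w n)` at time `n` and go back in time along `c k = meanGrowth α k n * c`.
The exponents
`(c (k + 1)) ^ 2 * d k = (c (k + 1)) ^ 2 * w (k + 1) - (c k) ^ 2 * w k` telescope, so that
`φ n c ≈ exp (-(t ^ 2 - (c K) ^ 2 * w K) / 2) * φ K (c K)` for each fixed large `K`, and the
accumulated error is a small multiple of `∑ k, (c k) ^ 2`, which the same telescoping bounds by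
`2 * t ^ 2` (`norm_charFun_walk_sub_exp_mul_le`). If moreover all the `c k` tend to `0` uniformly in
`k ≤ n`, then `φ n c → exp (-t ^ 2 / 2)` (`tendsto_charFun_walk`), and Lévy's continuity theorem
gives the convergence in distribution (`tendstoInDistribution_walk`).

Explicit asymptotic solutions `w` of the variance recursion are `k / (1 - 2 * α)` when `α < 1 / 2`
and `k * log k` when `α = 1 / 2`. The frequencies are uniformly small since
`|meanGrowth α k n| ≤ exp β * n ^ β` with `β = max α 0`, and the centering, being at
most of the order of `n ^ α`, disappears in the limit.
-/

/-! ### The increments and the range of the walk -/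

lemma ae_eq_one_or_eq_neg_one {Ω : Type*} [MeasurableSpace Ω] {μ : Measure Ω}
    [IsProbabilityMeasure μ] {f : Ω → ℤ} (hf : Measurable f) {r : ℝ}
    (h₁ : μ.real {ω | f ω = 1} = r) (h₂ : μ.real {ω | f ω = -1} = 1 - r) :
    ∀ᵐ ω ∂μ, f ω = 1 ∨ f ω = -1 := by
  have m₁ : MeasurableSet {ω | f ω = 1} := hf (measurableSet_singleton 1)
  have m₂ : MeasurableSet {ω | f ω = -1} := hf (measurableSet_singleton (-1))
  have hd : Disjoint {ω | f ω = 1} {ω | f ω = -1} := by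
    rw [Set.disjoint_left]
    intro ω h h'
    simp only [Set.mem_ofPred_eq] at h h'
    omega
  have hu : μ.real ({ω | f ω = 1} ∪ {ω | f ω = -1}) = 1 := by
    rw [measureReal_union hd m₂, h₁, h₂]; ring
  have hu' : μ ({ω | f ω = 1} ∪ {ω | f ω = -1}) = 1 := by
    rw [measureReal_def] at hu
    rwa [ENNReal.toReal_eq_one_iff] at hu
  filter_upwards [(mem_ae_iff_prob_eq_one (m₁.union m₂)).2 hu'] with ω hω using hω

namespace IsElephantRandomWalk

variable {Ω : Type*} [MeasurableSpace Ω] {μ : Measure Ω} {p q : ℝ}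
  {X η : ℕ → Ω → ℤ} {m : ℕ → Ω → ℕ} {ε : ℕ → Ω → ℤ}

lemma measurable_walk (h : IsElephantRandomWalk μ p q X η m ε) (n : ℕ) : Measurable (X n) := by
  induction n with
  | zero => simpa only [funext h.walk_zero] using measurable_const
  | succ n ih =>
    rw [show X (n + 1) = X n + η (n + 1) from funext (h.walk_succ n)]
    exact ih.add (h.measurable_increment (n + 1) (by omega))

lemma walk_eq_sum (h : IsElephantRandomWalk μ p q X η m ε) (n : ℕ) (ω : Ω) :
    X n ω = ∑ k ∈ Finset.Icc 1 n, η k ω := by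
  induction n with
  | zero => simp [h.walk_zero]
  | succ n ih => rw [h.walk_succ, ih, Finset.sum_Icc_succ_top (by omega)]

variable [IsProbabilityMeasure μ]

lemma ae_sign (h : IsElephantRandomWalk μ p q X η m ε) {n : ℕ} (hn : 1 ≤ n) :
    ∀ᵐ ω ∂μ, ε (n + 1) ω = 1 ∨ ε (n + 1) ω = -1 :=
  ae_eq_one_or_eq_neg_one (h.measurable_sign n hn) (h.sign_copy n hn) (h.sign_flip n hn)

lemma ae_time_mem (h : IsElephantRandomWalk μ p q X η m ε) {n : ℕ} (hn : 1 ≤ n) :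
    ∀ᵐ ω ∂μ, m (n + 1) ω ∈ Finset.Icc 1 n := by
  have hm : MeasurableSet {ω | m (n + 1) ω ∈ Finset.Icc 1 n} :=
    h.measurable_time n hn (Finset.measurableSet _)
  have hU : {ω | m (n + 1) ω ∈ Finset.Icc 1 n}
      = ⋃ k ∈ Finset.Icc 1 n, {ω | m (n + 1) ω = k} := by
    ext ω; simp
  have hr : μ.real {ω | m (n + 1) ω ∈ Finset.Icc 1 n} = 1 := by
    rw [hU, measureReal_biUnion_finset]
    · rw [Finset.sum_congr rfl (h.time_uniform n hn)]
      simp only [Finset.sum_const, Nat.card_Icc, nsmul_eq_mul, Nat.add_sub_cancel]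
      have : (n : ℝ) ≠ 0 := by positivity
      field_simp
    · intro i _ j _ hij
      refine Set.disjoint_left.2 fun ω h₁ h₂ => hij ?_
      exact h₁.symm.trans h₂
    · exact fun k _ => h.measurable_time n hn (measurableSet_singleton k)
  rw [measureReal_def, ENNReal.toReal_eq_one_iff] at hr
  exact (mem_ae_iff_prob_eq_one hm).2 hr

lemma ae_increment (h : IsElephantRandomWalk μ p q X η m ε) :
    ∀ᵐ ω ∂μ, ∀ n, 1 ≤ n → η n ω = 1 ∨ η n ω = -1 := by
  have h₁ := ae_eq_one_or_eq_neg_one (h.measurable_increment 1 le_rfl) h.first_right h.first_left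
  have h₂ : ∀ᵐ ω ∂μ, ∀ n, 1 ≤ n → ε (n + 1) ω = 1 ∨ ε (n + 1) ω = -1 :=
    ae_all_iff.2 fun n => by
      by_cases hn : 1 ≤ n
      · filter_upwards [h.ae_sign hn] with ω hω _ using hω
      · exact .of_forall fun _ h => absurd h hn
  have h₃ : ∀ᵐ ω ∂μ, ∀ n, 1 ≤ n → m (n + 1) ω ∈ Finset.Icc 1 n :=
    ae_all_iff.2 fun n => by
      by_cases hn : 1 ≤ n
      · filter_upwards [h.ae_time_mem hn] with ω hω _ using hω
      · exact .of_forall fun _ h => absurd h hn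
  have h₄ : ∀ᵐ ω ∂μ, ∀ n, 1 ≤ n → η (n + 1) ω = ε (n + 1) ω * η (m (n + 1) ω) ω :=
    ae_all_iff.2 fun n => by
      by_cases hn : 1 ≤ n
      · filter_upwards [h.increment_succ n hn] with ω hω _ using hω
      · exact .of_forall fun _ h => absurd h hn
  filter_upwards [h₁, h₂, h₃, h₄] with ω h₁ h₂ h₃ h₄ n
  induction n using Nat.strong_induction_on with
  | _ n ih =>
    intro hn
    obtain rfl | ⟨k, hk, rfl⟩ : n = 1 ∨ ∃ k, 1 ≤ k ∧ n = k + 1 := by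
      rcases Nat.lt_or_ge n 2 with h | h
      · left; omega
      · exact .inr ⟨n - 1, by omega, by omega⟩
    · exact h₁
    · have hm := Finset.mem_Icc.1 (h₃ k hk)
      rw [h₄ k hk]
      rcases h₂ k hk with e | e <;> rcases ih _ (by omega) hm.1 with e' | e' <;> simp [e, e']

lemma ae_abs_walk_le (h : IsElephantRandomWalk μ p q X η m ε) (n : ℕ) :
    ∀ᵐ ω ∂μ, |X n ω| ≤ n := by
  filter_upwards [h.ae_increment] with ω hω
  rw [h.walk_eq_sum]
  refine (Finset.abs_sum_le_sum_abs _ _).trans ?_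
  calc ∑ k ∈ Finset.Icc 1 n, |η k ω| ≤ ∑ k ∈ Finset.Icc 1 n, 1 := by
        refine Finset.sum_le_sum fun k hk => ?_
        rcases hω k (Finset.mem_Icc.1 hk).1 with e | e <;> simp [e]
    _ = n := by simp

variable {𝕜 : Type*} [RCLike 𝕜]

/-- At a fixed time the walk takes finitely many values, so that all functions of it are
integrable. -/
lemma integrable_comp_walk (h : IsElephantRandomWalk μ p q X η m ε) (n : ℕ) (F : ℤ → 𝕜) :
    Integrable (fun ω => F (X n ω)) μ := by
  refine Integrable.of_bound (C := ∑ x ∈ Finset.Icc (-n : ℤ) n, ‖F x‖) ?_ ?_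
  · exact ((measurable_of_countable F).comp (h.measurable_walk n)).aestronglyMeasurable
  · filter_upwards [h.ae_abs_walk_le n] with ω hω
    exact Finset.single_le_sum (f := fun x => ‖F x‖) (fun _ _ => norm_nonneg _)
      (Finset.mem_Icc.2 (abs_le.1 hω))

lemma integrable_comp_walk_mul_increment (h : IsElephantRandomWalk μ p q X η m ε) (n : ℕ)
    (F : ℤ → 𝕜) {k : ℕ} (hk : 1 ≤ k) :
    Integrable (fun ω => F (X n ω) * (η k ω : 𝕜)) μ := by
  refine (h.integrable_comp_walk n F).norm.mono' ?_ ?_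
  · exact (((measurable_of_countable F).comp (h.measurable_walk n)).mul
      ((measurable_of_countable (fun z : ℤ => (z : 𝕜))).comp
        (h.measurable_increment k hk))).aestronglyMeasurable
  · filter_upwards [h.ae_increment] with ω hω
    rcases hω k hk with e | e <;> simp [e]

lemma integral_sign (h : IsElephantRandomWalk μ p q X η m ε) {n : ℕ} (hn : 1 ≤ n) :
    ∫ ω, (ε (n + 1) ω : 𝕜) ∂μ = ((2 * p - 1 : ℝ) : 𝕜) := by
  have hm := h.measurable_sign n hn
  have m₁ : MeasurableSet {ω | ε (n + 1) ω = 1} := hm (measurableSet_singleton 1)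
  have m₂ : MeasurableSet {ω | ε (n + 1) ω = -1} := hm (measurableSet_singleton (-1))
  have e : (fun ω => (ε (n + 1) ω : 𝕜)) =ᵐ[μ]
      fun ω => Set.indicator {ω | ε (n + 1) ω = 1} (fun _ => (1 : 𝕜)) ω
        - Set.indicator {ω | ε (n + 1) ω = -1} (fun _ => (1 : 𝕜)) ω := by
    filter_upwards [h.ae_sign hn] with ω hω
    rcases hω with e | e <;> simp [e]
  rw [integral_congr_ae e, integral_sub ((integrable_const _).indicator m₁)
    ((integrable_const _).indicator m₂), integral_indicator_const _ m₁,
    integral_indicator_const _ m₂, h.sign_copy n hn, h.sign_flip n hn, ← sub_smul,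
    RCLike.real_smul_eq_coe_mul, mul_one]
  congr 1
  ring

lemma integral_time_mul_sign (h : IsElephantRandomWalk μ p q X η m ε) {n : ℕ} (hn : 1 ≤ n)
    {k : ℕ} (hk : k ∈ Finset.Icc 1 n) :
    ∫ ω, (if m (n + 1) ω = k then 1 else 0) * (ε (n + 1) ω : 𝕜) ∂μ
      = (((2 * p - 1) / n : ℝ) : 𝕜) := by
  have hmk : MeasurableSet {ω | m (n + 1) ω = k} :=
    h.measurable_time n hn (measurableSet_singleton k)
  have key := (h.indep_time_sign n hn).integral_fun_comp_mul_comp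
    (f := fun j : ℕ => if j = k then (1 : 𝕜) else 0) (g := fun z : ℤ => (z : 𝕜))
    (h.measurable_time n hn).aemeasurable (h.measurable_sign n hn).aemeasurable
    (measurable_of_countable _).aestronglyMeasurable
    (measurable_of_countable _).aestronglyMeasurable
  rw [key, h.integral_sign hn]
  have : (fun ω => if m (n + 1) ω = k then (1 : 𝕜) else 0)
      = Set.indicator {ω | m (n + 1) ω = k} (fun _ => (1 : 𝕜)) := by
    ext ω; simp [Set.indicator_apply]
  rw [this, integral_indicator_const _ hmk, h.time_uniform n hn k hk,
    RCLike.real_smul_eq_coe_mul, mul_one, ← RCLike.ofReal_mul]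
  congr 1
  ring

/-- The conditional mean of the next increment given the past is `(2 * p - 1) * X n / n`; this is
its form tested against functions of `X n`. -/
lemma integral_comp_walk_mul_increment_succ (h : IsElephantRandomWalk μ p q X η m ε) {n : ℕ}
    (hn : 1 ≤ n) (F : ℤ → 𝕜) :
    ∫ ω, F (X n ω) * (η (n + 1) ω : 𝕜) ∂μ
      = (((2 * p - 1) / n : ℝ) : 𝕜) * ∫ ω, F (X n ω) * (X n ω : 𝕜) ∂μ := by
  -- split according to the remembered time
  have e : (fun ω => F (X n ω) * (η (n + 1) ω : 𝕜)) =ᵐ[μ] fun ω => ∑ k ∈ Finset.Icc 1 n,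
      ((if m (n + 1) ω = k then 1 else 0) * (ε (n + 1) ω : 𝕜)) * (F (X n ω) * (η k ω : 𝕜)) := by
    filter_upwards [h.increment_succ n hn, h.ae_time_mem hn] with ω h₁ h₂
    rw [Finset.sum_eq_single_of_mem _ h₂]
    · rw [h₁]; push_cast; simp; ring
    · intro k _ hk
      simp [hk.symm]
  have hind : ∀ k ∈ Finset.Icc 1 n,
      IndepFun (fun ω => (if m (n + 1) ω = k then 1 else 0) * (ε (n + 1) ω : 𝕜))
        (fun ω => F (X n ω) * (η k ω : 𝕜)) μ := by
    intro k hk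
    have := (h.indep_past n hn).comp
      (φ := fun z : ℕ × ℤ => (if z.1 = k then (1 : 𝕜) else 0) * (z.2 : 𝕜))
      (ψ := fun v : Finset.Icc 1 n → ℤ => F (∑ j, v j) * (v ⟨k, hk⟩ : 𝕜))
      (measurable_of_countable _) (measurable_of_countable _)
    convert! this using 1
    ext ω
    rw [Function.comp_apply, h.walk_eq_sum, ← Finset.sum_coe_sort (Finset.Icc 1 n) (fun k => η k ω)]
  have hmε : ∀ k, Measurable
      (fun ω => (if m (n + 1) ω = k then 1 else 0) * (ε (n + 1) ω : 𝕜)) := fun k =>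
    (measurable_of_countable (fun z : ℕ × ℤ => (if z.1 = k then (1 : 𝕜) else 0) * (z.2 : 𝕜))).comp
      ((h.measurable_time n hn).prodMk (h.measurable_sign n hn))
  have hI : ∀ k ∈ Finset.Icc 1 n, Integrable
      (fun ω => (if m (n + 1) ω = k then 1 else 0) * (ε (n + 1) ω : 𝕜)) μ := by
    intro k _
    refine Integrable.of_bound (C := 1) (hmε k).aestronglyMeasurable ?_
    filter_upwards [h.ae_sign hn] with ω hω
    rcases hω with e | e <;> split_ifs <;> simp [e]
  rw [integral_congr_ae e, integral_finsetSum]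
  · have : ∀ k ∈ Finset.Icc 1 n, ∫ ω, ((if m (n + 1) ω = k then 1 else 0) * (ε (n + 1) ω : 𝕜))
          * (F (X n ω) * (η k ω : 𝕜)) ∂μ
        = (((2 * p - 1) / n : ℝ) : 𝕜) * ∫ ω, F (X n ω) * (η k ω : 𝕜) ∂μ := by
      intro k hk
      rw [(hind k hk).integral_fun_mul_eq_mul_integral (hmε k).aestronglyMeasurable
        (h.integrable_comp_walk_mul_increment n F (Finset.mem_Icc.1 hk).1).aestronglyMeasurable,
        h.integral_time_mul_sign hn hk]
    rw [Finset.sum_congr rfl this, ← Finset.mul_sum, ← integral_finsetSum]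
    · congr 2
      ext ω
      rw [← Finset.mul_sum, h.walk_eq_sum]
      push_cast
      rfl
    · exact fun k hk => h.integrable_comp_walk_mul_increment n F (Finset.mem_Icc.1 hk).1
  · exact fun k hk => (hind k hk).integrable_mul (hI k hk)
      (h.integrable_comp_walk_mul_increment n F (Finset.mem_Icc.1 hk).1)

/-! ### The second moment -/

lemma integral_walk_sq_succ (h : IsElephantRandomWalk μ p q X η m ε) {n : ℕ} (hn : 1 ≤ n) :
    ∫ ω, (X (n + 1) ω : ℝ) ^ 2 ∂μ
      = (1 + 2 * ((2 * p - 1) / n)) * ∫ ω, (X n ω : ℝ) ^ 2 ∂μ + 1 := by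
  have e : (fun ω => (X (n + 1) ω : ℝ) ^ 2) =ᵐ[μ]
      fun ω => (X n ω : ℝ) ^ 2 + 2 * ((X n ω : ℝ) * (η (n + 1) ω : ℝ)) + 1 := by
    filter_upwards [h.ae_increment] with ω hω
    rw [h.walk_succ]
    rcases hω (n + 1) (by omega) with e | e <;> rw [e] <;> push_cast <;> ring
  have i₁ := h.integrable_comp_walk n (fun x => (x : ℝ) ^ 2)
  have i₂ := (h.integrable_comp_walk_mul_increment n (fun x => (x : ℝ))
    (k := n + 1) (by omega)).const_mul 2
  have key := h.integral_comp_walk_mul_increment_succ hn (fun x => (x : ℝ))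
  rw [integral_congr_ae e, integral_add (by exact i₁.add i₂) (integrable_const _),
    integral_add i₁ i₂, integral_const_mul]
  simp only [RCLike.ofReal_real_eq_id, id_eq] at key ⊢
  rw [key]
  simp [pow_two]
  ring

/-- For `p ≤ 3 / 4` the second moment of the walk at time `n` is at most `n * (1 + log n)`. -/
lemma integral_walk_sq_le (h : IsElephantRandomWalk μ p q X η m ε) (hp : p ≤ 3 / 4) {n : ℕ}
    (hn : 1 ≤ n) : ∫ ω, (X n ω : ℝ) ^ 2 ∂μ ≤ n * (1 + Real.log n) := by
  have key : ∫ ω, (X n ω : ℝ) ^ 2 ∂μ ≤ n * harmonic n := by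
    induction n, hn using Nat.le_induction with
    | base =>
      have e : (fun ω => (X 1 ω : ℝ) ^ 2) =ᵐ[μ] fun _ => 1 := by
        filter_upwards [h.ae_increment] with ω hω
        rw [h.walk_succ 0, h.walk_zero]
        rcases hω 1 le_rfl with e | e <;> simp [e]
      rw [integral_congr_ae e]
      simp
    | succ n hn ih =>
      have hn' : (0 : ℝ) < n := by exact_mod_cast hn
      rw [h.integral_walk_sq_succ hn, harmonic_succ]
      have h₀ : 0 ≤ ∫ ω, (X n ω : ℝ) ^ 2 ∂μ := integral_nonneg fun _ => sq_nonneg _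
      have h₁ : 2 * ((2 * p - 1) / n) ≤ 1 / (n : ℝ) := by
        rw [← mul_div_assoc]; gcongr; linarith
      calc (1 + 2 * ((2 * p - 1) / n)) * ∫ ω, (X n ω : ℝ) ^ 2 ∂μ + 1
          ≤ (1 + 1 / (n : ℝ)) * (n * harmonic n) + 1 := by
            have : 0 ≤ 1 + 1 / (n : ℝ) := by positivity
            nlinarith [mul_le_mul_of_nonneg_left ih this, mul_le_mul_of_nonneg_right h₁ h₀]
        _ = _ := by push_cast; field_simp
  refine key.trans ?_
  gcongr
  exact harmonic_le_one_add_log n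

end IsElephantRandomWalk

/-! ### The characteristic function of one step -/

lemma norm_exp_mul_I_sub_taylor_le {θ : ℝ} (hθ : |θ| ≤ 1) :
    ‖Complex.exp (θ * Complex.I) - (1 + θ * Complex.I - θ ^ 2 / 2)‖ ≤ |θ| ^ 3 := by
  have hx : ‖(θ : ℂ) * Complex.I‖ = |θ| := by simp
  have key := Complex.exp_bound (x := (θ : ℂ) * Complex.I) (by rwa [hx]) (n := 3) (by norm_num)
  rw [hx] at key
  have e : ∑ m ∈ Finset.range 3, ((θ : ℂ) * Complex.I) ^ m / (m.factorial : ℂ)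
      = 1 + θ * Complex.I - θ ^ 2 / 2 := by
    simp [Finset.sum_range_succ, mul_pow]
    ring
  rw [e] at key
  refine key.trans (mul_le_of_le_one_right (by positivity) ?_)
  norm_num [Nat.factorial]

/-- Let `ξ = ±1` have mean `y`. The characteristic function of `ξ - y` at `c` is
`1 - c ^ 2 * (1 - y ^ 2) / 2` up to third order in `c`, and so is close to
`exp (-c ^ 2 * d / 2)` when `y` and `1 - d` are small. -/
lemma norm_charFun_sign_sub_exp_le {c y d : ℝ} (hc : |c| ≤ 1 / 2) (hy : |y| ≤ 1)
    (hd₀ : 0 ≤ d) (hd₂ : d ≤ 2) :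
    ‖Complex.exp ((-(c * y) : ℝ) * Complex.I) * (Real.cos c + y * Real.sin c * Complex.I)
      - (Real.exp (-(c ^ 2 * d / 2)) : ℝ)‖ ≤ 9 * |c| ^ 3 + c ^ 2 / 2 * (y ^ 2 + |1 - d|) := by
  obtain ⟨hy₁, hy₂⟩ := abs_le.1 hy
  have bnd : ∀ s : ℝ, |s| ≤ 2 → |c * s| ≤ 1 ∧ |c * s| ^ 3 ≤ 8 * |c| ^ 3 := by
    intro s hs
    have h₀ : |c * s| ≤ |c| * 2 := by rw [abs_mul]; gcongr
    refine ⟨by linarith, (pow_le_pow_left₀ (abs_nonneg _) h₀ 3).trans_eq (by ring)⟩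
  obtain ⟨a₁, a₂⟩ := bnd (1 - y) (abs_le.2 ⟨by linarith, by linarith⟩)
  obtain ⟨b₁, b₂⟩ := bnd (-1 - y) (abs_le.2 ⟨by linarith, by linarith⟩)
  have ta := (norm_exp_mul_I_sub_taylor_le a₁).trans a₂
  have tb := (norm_exp_mul_I_sub_taylor_le b₁).trans b₂
  set A := Complex.exp ((c * (1 - y) : ℝ) * Complex.I)
    - (1 + (c * (1 - y) : ℝ) * Complex.I - (c * (1 - y) : ℝ) ^ 2 / 2) with hA
  set B := Complex.exp ((c * (-1 - y) : ℝ) * Complex.I)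
    - (1 + (c * (-1 - y) : ℝ) * Complex.I - (c * (-1 - y) : ℝ) ^ 2 / 2) with hB
  set r := Real.exp (-(c ^ 2 * d / 2)) - 1 - (-(c ^ 2 * d / 2)) with hr
  have hc2 : c ^ 2 ≤ 1 / 4 := by
    rw [← sq_abs]; nlinarith [abs_nonneg c]
  have hr_le : |r| ≤ |c| ^ 3 := by
    have hδ : ‖-(c ^ 2 * d / 2)‖ ≤ 1 := by
      rw [norm_neg, Real.norm_eq_abs, abs_of_nonneg (by positivity)]
      nlinarith [sq_nonneg c]
    have := Real.norm_exp_sub_one_sub_id_le hδ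
    rw [Real.norm_eq_abs, norm_neg, Real.norm_eq_abs, sq_abs] at this
    refine this.trans ?_
    have h4 : (c ^ 2 * d / 2) ^ 2 ≤ (c ^ 2) ^ 2 := by
      gcongr
      nlinarith [sq_nonneg c]
    refine h4.trans ?_
    calc (c ^ 2) ^ 2 = |c| ^ 3 * |c| := by rw [← sq_abs c]; ring
      _ ≤ |c| ^ 3 * 1 := by gcongr; linarith
      _ = |c| ^ 3 := mul_one _
  -- `A` and `B` are the Taylor remainders at the two values of `ξ`, and `r` that of the real
  -- exponential
  have split : Complex.exp ((-(c * y) : ℝ) * Complex.I)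
        * (Real.cos c + y * Real.sin c * Complex.I) - (Real.exp (-(c ^ 2 * d / 2)) : ℝ)
      = ((1 + y) / 2 : ℝ) * A + ((1 - y) / 2 : ℝ) * B - (r : ℝ)
        + (c ^ 2 / 2 * (y ^ 2 - (1 - d)) : ℝ) := by
    have ea : Complex.exp ((c * (1 - y) : ℝ) * Complex.I)
        = Complex.exp ((-(c * y) : ℝ) * Complex.I)
          * (Real.cos c + Real.sin c * Complex.I) := by
      rw [Complex.ofReal_cos, Complex.ofReal_sin, ← Complex.exp_mul_I, ← Complex.exp_add]
      congr 1; push_cast; ring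
    have eb : Complex.exp ((c * (-1 - y) : ℝ) * Complex.I)
        = Complex.exp ((-(c * y) : ℝ) * Complex.I)
          * (Real.cos c - Real.sin c * Complex.I) := by
      have hneg : (Real.cos c - Real.sin c * Complex.I : ℂ)
          = Complex.exp ((-c : ℝ) * Complex.I) := by
        rw [Complex.exp_mul_I, ← Complex.ofReal_cos, ← Complex.ofReal_sin, Real.cos_neg,
          Real.sin_neg]
        push_cast; ring
      rw [hneg, ← Complex.exp_add]
      congr 1; push_cast; ring
    rw [hA, hB, hr, ea, eb]
    push_cast
    ring_nf
  rw [split]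
  have n₁ : ‖(((1 + y) / 2 : ℝ) : ℂ) * A‖ ≤ (1 + y) / 2 * (8 * |c| ^ 3) := by
    rw [norm_mul, Complex.norm_real, Real.norm_eq_abs, abs_of_nonneg (by linarith)]
    exact mul_le_mul_of_nonneg_left ta (by linarith)
  have n₂ : ‖(((1 - y) / 2 : ℝ) : ℂ) * B‖ ≤ (1 - y) / 2 * (8 * |c| ^ 3) := by
    rw [norm_mul, Complex.norm_real, Real.norm_eq_abs, abs_of_nonneg (by linarith)]
    exact mul_le_mul_of_nonneg_left tb (by linarith)
  have n₃ : ‖(r : ℂ)‖ ≤ |c| ^ 3 := by rwa [Complex.norm_real]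
  have n₄ : ‖((c ^ 2 / 2 * (y ^ 2 - (1 - d)) : ℝ) : ℂ)‖ ≤ c ^ 2 / 2 * (y ^ 2 + |1 - d|) := by
    rw [Complex.norm_real, Real.norm_eq_abs, abs_mul, abs_of_nonneg (by positivity)]
    gcongr
    exact (abs_sub _ _).trans_eq (by rw [abs_of_nonneg (sq_nonneg y)])
  calc _ ≤ _ := norm_add_le _ _
    _ ≤ _ := add_le_add_left (norm_sub_le _ _) _
    _ ≤ _ := add_le_add_left (add_le_add_left (norm_add_le _ _) _) _
    _ ≤ _ := add_le_add (add_le_add (add_le_add n₁ n₂) n₃) n₄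
    _ = _ := by ring

namespace IsElephantRandomWalk

variable {Ω : Type*} [MeasurableSpace Ω] {μ : Measure Ω} {p q : ℝ}
  {X η : ℕ → Ω → ℤ} {m : ℕ → Ω → ℕ} {ε : ℕ → Ω → ℤ}

lemma charFun_walk (h : IsElephantRandomWalk μ p q X η m ε) (n : ℕ) (c : ℝ) :
    charFun (μ.map fun ω => (X n ω : ℝ)) c
      = ∫ ω, Complex.exp ((c * X n ω : ℝ) * Complex.I) ∂μ := by
  rw [charFun_apply_real, integral_map]
  · simp
  · exact ((measurable_of_countable fun z : ℤ => (z : ℝ)).comp (h.measurable_walk n)).aemeasurable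
  · fun_prop

variable [IsProbabilityMeasure μ]

lemma charFun_walk_succ (h : IsElephantRandomWalk μ p q X η m ε) {n : ℕ} (hn : 1 ≤ n) (c : ℝ) :
    charFun (μ.map fun ω => (X (n + 1) ω : ℝ)) c
      = ∫ ω, Complex.exp ((c * X n ω : ℝ) * Complex.I) * (Real.cos c
          + ((2 * p - 1) / n * X n ω : ℝ) * Real.sin c * Complex.I) ∂μ := by
  have e : (fun ω => Complex.exp ((c * X (n + 1) ω : ℝ) * Complex.I)) =ᵐ[μ]
      fun ω => Complex.exp ((c * X n ω : ℝ) * Complex.I) * Real.cos c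
        + (Real.sin c * Complex.I)
          * (Complex.exp ((c * X n ω : ℝ) * Complex.I) * (η (n + 1) ω : ℂ)) := by
    filter_upwards [h.ae_increment] with ω hω
    have hs : Complex.exp ((c * η (n + 1) ω : ℝ) * Complex.I)
        = Real.cos c + Real.sin c * Complex.I * (η (n + 1) ω : ℂ) := by
      rw [Complex.exp_mul_I, ← Complex.ofReal_cos, ← Complex.ofReal_sin]
      rcases hω (n + 1) (by omega) with e | e <;> rw [e] <;> simp
    rw [h.walk_succ, show (((c * ((X n ω + η (n + 1) ω : ℤ) : ℝ) : ℝ) : ℂ) * Complex.I)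
      = (c * X n ω : ℝ) * Complex.I + (c * η (n + 1) ω : ℝ) * Complex.I by push_cast; ring,
      Complex.exp_add, hs]
    ring
  set F : ℤ → ℂ := fun x => Complex.exp ((c * x : ℝ) * Complex.I) with hF
  have i₁ : Integrable (fun ω => F (X n ω) * Real.cos c) μ :=
    h.integrable_comp_walk n (fun x => F x * Real.cos c)
  have i₂ : Integrable (fun ω => (Real.sin c * Complex.I) * (F (X n ω) * (η (n + 1) ω : ℂ))) μ :=
    (h.integrable_comp_walk_mul_increment n F (k := n + 1) (by omega)).const_mul _
  have i₃ : Integrable (fun ω => (Real.sin c * Complex.I) * ((((2 * p - 1) / n : ℝ) : ℂ)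
      * (F (X n ω) * (X n ω : ℂ)))) μ :=
    h.integrable_comp_walk n (fun x => (Real.sin c * Complex.I) * ((((2 * p - 1) / n : ℝ) : ℂ)
      * (F x * (x : ℂ))))
  rw [h.charFun_walk, integral_congr_ae e]
  have key : ∫ ω, F (X n ω) * (η (n + 1) ω : ℂ) ∂μ
      = (((2 * p - 1) / n : ℝ) : ℂ) * ∫ ω, F (X n ω) * (X n ω : ℂ) ∂μ :=
    h.integral_comp_walk_mul_increment_succ hn F
  rw [integral_add i₁ i₂, integral_const_mul, key, ← integral_const_mul, ← integral_const_mul,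
    ← integral_add i₁ i₃]
  refine integral_congr_ae (.of_forall fun ω => ?_)
  simp only [hF]
  push_cast
  ring

/-- One step of the walk acts on characteristic functions as the dilation by
`1 + (2 * p - 1) / n`, times an approximately Gaussian factor. -/
lemma norm_charFun_walk_succ_sub_le (h : IsElephantRandomWalk μ p q X η m ε)
    (hp : p ∈ Set.Icc (0 : ℝ) 1) {n : ℕ} (hn : 1 ≤ n) {c d : ℝ} (hc : |c| ≤ 1 / 2)
    (hd₀ : 0 ≤ d) (hd₂ : d ≤ 2) :
    ‖charFun (μ.map fun ω => (X (n + 1) ω : ℝ)) c - (Real.exp (-(c ^ 2 * d / 2)) : ℝ)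
        * charFun (μ.map fun ω => (X n ω : ℝ)) ((1 + (2 * p - 1) / n) * c)‖
      ≤ 9 * |c| ^ 3 + c ^ 2 / 2 * ((∫ ω, (X n ω : ℝ) ^ 2 ∂μ) / n ^ 2 + |1 - d|) := by
  have hn' : (0 : ℝ) < n := by exact_mod_cast hn
  have hα : |2 * p - 1| ≤ 1 := abs_le.2 ⟨by linarith [hp.1], by linarith [hp.2]⟩
  rw [h.charFun_walk_succ hn, h.charFun_walk, ← integral_const_mul, ← integral_sub]
  rotate_left
  · exact h.integrable_comp_walk n (fun x => Complex.exp ((c * x : ℝ) * Complex.I)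
      * (Real.cos c + ((2 * p - 1) / n * x : ℝ) * Real.sin c * Complex.I))
  · exact h.integrable_comp_walk n (fun x => ((Real.exp (-(c ^ 2 * d / 2)) : ℝ) : ℂ)
      * Complex.exp (((1 + (2 * p - 1) / n) * c * x : ℝ) * Complex.I))
  have hint := (h.integrable_comp_walk n (fun x => (x : ℝ) ^ 2)).div_const ((n : ℝ) ^ 2)
  calc _ ≤ ∫ ω, (9 * |c| ^ 3 + c ^ 2 / 2 * ((X n ω : ℝ) ^ 2 / n ^ 2 + |1 - d|)) ∂μ := by
        refine norm_integral_le_of_norm_le ?_ ?_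
        · exact (integrable_const _).add ((hint.add (integrable_const _)).const_mul _)
        · filter_upwards [h.ae_abs_walk_le n] with ω hω
          set y := (2 * p - 1) / n * (X n ω : ℝ) with hy
          have hXn : |(X n ω : ℝ)| ≤ n := by exact_mod_cast hω
          have hy' : |y| ≤ |(X n ω : ℝ)| / n := by
            rw [hy, abs_mul, abs_div, abs_of_pos hn']
            calc |2 * p - 1| / n * |(X n ω : ℝ)| ≤ 1 / n * |(X n ω : ℝ)| := by gcongr
              _ = _ := by ring
          have hy₁ : |y| ≤ 1 := hy'.trans ((div_le_one hn').2 hXn)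
          have hy₂ : y ^ 2 ≤ (X n ω : ℝ) ^ 2 / n ^ 2 := by
            rw [← sq_abs y, ← sq_abs (X n ω : ℝ), ← div_pow]; gcongr
          -- factor out the unimodular exponential of the dilated walk
          have e : Complex.exp ((c * X n ω : ℝ) * Complex.I)
                * (Real.cos c + (y : ℝ) * Real.sin c * Complex.I)
              - (Real.exp (-(c ^ 2 * d / 2)) : ℝ)
                * Complex.exp (((1 + (2 * p - 1) / n) * c * X n ω : ℝ) * Complex.I)
              = Complex.exp (((1 + (2 * p - 1) / n) * c * X n ω : ℝ) * Complex.I)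
                * (Complex.exp ((-(c * y) : ℝ) * Complex.I)
                  * (Real.cos c + y * Real.sin c * Complex.I)
                    - (Real.exp (-(c ^ 2 * d / 2)) : ℝ)) := by
            have : Complex.exp ((c * X n ω : ℝ) * Complex.I)
                = Complex.exp (((1 + (2 * p - 1) / n) * c * X n ω : ℝ) * Complex.I)
                  * Complex.exp ((-(c * y) : ℝ) * Complex.I) := by
              rw [← Complex.exp_add, hy]; congr 1; push_cast; ring
            rw [this]; ring
          rw [e, norm_mul, Complex.norm_exp_ofReal_mul_I, one_mul]
          refine (norm_charFun_sign_sub_exp_le hc hy₁ hd₀ hd₂).trans ?_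
          gcongr
    _ = _ := by
        rw [integral_add (integrable_const _)
          (by exact (hint.add (integrable_const _)).const_mul _), integral_const_mul (c ^ 2 / 2),
          integral_add (by exact hint) (integrable_const _), integral_div]
        simp

/-- The characteristic function of the walk at a fixed time is close to `1` near the origin. -/
lemma norm_charFun_walk_sub_one_le (h : IsElephantRandomWalk μ p q X η m ε) (n : ℕ) (c : ℝ) :
    ‖charFun (μ.map fun ω => (X n ω : ℝ)) c - 1‖ ≤ |c| * n := by
  have e : charFun (μ.map fun ω => (X n ω : ℝ)) c - 1
      = ∫ ω, (Complex.exp ((c * X n ω : ℝ) * Complex.I) - 1) ∂μ := by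
    rw [h.charFun_walk, integral_sub
      (h.integrable_comp_walk n fun x => Complex.exp ((c * x : ℝ) * Complex.I))
      (integrable_const _)]
    simp
  rw [e]
  refine (norm_integral_le_of_norm_le_const (C := |c| * n) ?_).trans_eq (by simp)
  filter_upwards [h.ae_abs_walk_le n] with ω hω
  have hXn : |(X n ω : ℝ)| ≤ n := by exact_mod_cast hω
  rw [mul_comm _ Complex.I]
  refine (Real.norm_exp_I_mul_ofReal_sub_one_le).trans ?_
  rw [Real.norm_eq_abs, abs_mul]
  gcongr

end IsElephantRandomWalk

/-! ### Products of the mean growth factors -/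

/-- The factor `∏_{k ≤ j < n} (1 + α / j)` by which the conditional mean of the walk with
`α = 2 * p - 1` grows between the times `k` and `n`. -/
noncomputable def meanGrowth (α : ℝ) (k n : ℕ) : ℝ := ∏ j ∈ Finset.Ico k n, (1 + α / j)

@[simp] lemma meanGrowth_self (α : ℝ) (n : ℕ) : meanGrowth α n n = 1 := by simp [meanGrowth]

lemma meanGrowth_eq_mul (α : ℝ) {k n : ℕ} (h : k < n) :
    meanGrowth α k n = (1 + α / k) * meanGrowth α (k + 1) n :=
  Finset.prod_eq_prod_Ico_succ_bot h _

lemma abs_meanGrowth_le {α β : ℝ} (hα : -1 ≤ α) (hαβ : α ≤ β) (hβ : 0 ≤ β) {k n : ℕ}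
    (hk : 1 ≤ k) (hkn : k ≤ n) : |meanGrowth α k n| ≤ Real.exp β * (n : ℝ) ^ β := by
  have hn : (0 : ℝ) < n := by exact_mod_cast hk.trans hkn
  have hfac : ∀ j ∈ Finset.Ico k n, |1 + α / j| ≤ Real.exp (β * (j : ℝ)⁻¹) := by
    intro j hj
    have hj₁ : (1 : ℝ) ≤ j := by exact_mod_cast hk.trans (Finset.mem_Ico.1 hj).1
    have hj₀ : (0 : ℝ) < j := by linarith
    have h₁ : -1 ≤ α / j := by rw [le_div_iff₀ hj₀]; linarith
    have h₂ : α / j ≤ β * (j : ℝ)⁻¹ := by rw [← div_eq_mul_inv]; gcongr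
    rw [abs_of_nonneg (by linarith)]
    linarith [Real.add_one_le_exp (β * (j : ℝ)⁻¹)]
  have hsum : ∑ j ∈ Finset.Ico k n, (j : ℝ)⁻¹ ≤ 1 + Real.log n := by
    refine le_trans ?_ (harmonic_le_one_add_log n)
    rw [harmonic_eq_sum_Icc]
    push_cast
    refine Finset.sum_le_sum_of_subset_of_nonneg (fun j hj => ?_) fun _ _ _ => by positivity
    rw [Finset.mem_Ico] at hj
    exact Finset.mem_Icc.2 ⟨by omega, by omega⟩
  rw [meanGrowth, Finset.abs_prod]
  calc _ ≤ ∏ j ∈ Finset.Ico k n, Real.exp (β * (j : ℝ)⁻¹) :=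
        Finset.prod_le_prod (fun _ _ => abs_nonneg _) hfac
    _ = Real.exp (β * ∑ j ∈ Finset.Ico k n, (j : ℝ)⁻¹) := by
        rw [← Real.exp_sum, Finset.mul_sum]
    _ ≤ Real.exp (β * (1 + Real.log n)) := by gcongr
    _ = Real.exp β * (n : ℝ) ^ β := by
        rw [Real.rpow_def_of_pos hn, ← Real.exp_add]; ring_nf

/-! ### The central limit theorem under a norming recursion -/

namespace IsElephantRandomWalk

variable {Ω : Type*} [MeasurableSpace Ω] {μ : Measure Ω} [IsProbabilityMeasure μ] {p q : ℝ}
  {X η : ℕ → Ω → ℤ} {m : ℕ → Ω → ℕ} {ε : ℕ → Ω → ℤ}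

/-- The one-step estimates added up from time `K` to time `N`, along the frequencies
`meanGrowth (2 * p - 1) k n * c`. The Gaussian factors telescope into differences of
`(meanGrowth (2 * p - 1) k n * c) ^ 2 * w k`, and since each of them is at most `1` the errors
add up without amplification. -/
lemma norm_charFun_walk_sub_exp_mul_le (h : IsElephantRandomWalk μ p q X η m ε)
    (hp : p ∈ Set.Icc (0 : ℝ) 1) (w : ℕ → ℝ) {K n : ℕ} (hK : 1 ≤ K) {c δ ρ : ℝ} (hδ : δ ≤ 1 / 2)
    (hfreq : ∀ k, K ≤ k → k ≤ n → |meanGrowth (2 * p - 1) k n * c| ≤ δ)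
    (hlow : ∀ k, K ≤ k → 1 / 2 ≤ w (k + 1) - (1 + (2 * p - 1) / k) ^ 2 * w k)
    (hupp : ∀ k, K ≤ k → w (k + 1) - (1 + (2 * p - 1) / k) ^ 2 * w k ≤ 2)
    (hρ : ∀ k, K ≤ k → (∫ ω, (X k ω : ℝ) ^ 2 ∂μ) / k ^ 2
      + |1 - (w (k + 1) - (1 + (2 * p - 1) / k) ^ 2 * w k)| ≤ ρ)
    {N : ℕ} (hKN : K ≤ N) (hNn : N ≤ n) :
    ‖charFun (μ.map fun ω => (X N ω : ℝ)) (meanGrowth (2 * p - 1) N n * c)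
      - (Real.exp (-(((meanGrowth (2 * p - 1) N n * c) ^ 2 * w N
          - (meanGrowth (2 * p - 1) K n * c) ^ 2 * w K) / 2)) : ℝ)
        * charFun (μ.map fun ω => (X K ω : ℝ)) (meanGrowth (2 * p - 1) K n * c)‖
      ≤ (18 * δ + ρ) * ((meanGrowth (2 * p - 1) N n * c) ^ 2 * w N
          - (meanGrowth (2 * p - 1) K n * c) ^ 2 * w K) := by
  induction N, hKN using Nat.le_induction with
  | base => simp
  | succ N hKN ih =>
    specialize ih (by omega)
    have hgrow := meanGrowth_eq_mul (2 * p - 1) (show N < n by omega)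
    have hb := hfreq (N + 1) (by omega) hNn
    set b := meanGrowth (2 * p - 1) (N + 1) n * c with hb_def
    have ha : meanGrowth (2 * p - 1) N n * c = (1 + (2 * p - 1) / N) * b := by
      rw [hgrow, hb_def]; ring
    rw [ha] at ih
    set A := (meanGrowth (2 * p - 1) K n * c) ^ 2 * w K
    set Φ := charFun (μ.map fun ω => (X K ω : ℝ)) (meanGrowth (2 * p - 1) K n * c)
    set d := w (N + 1) - (1 + (2 * p - 1) / N) ^ 2 * w N with hd
    have hd₁ := hlow N hKN
    have hstep := h.norm_charFun_walk_succ_sub_le hp (hK.trans hKN) (hb.trans hδ)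
      (by linarith : 0 ≤ d) (hupp N hKN)
    set a := (1 + (2 * p - 1) / N) * b with ha_def
    have hbd : b ^ 2 * d = b ^ 2 * w (N + 1) - a ^ 2 * w N := by rw [hd, ha_def]; ring
    have hδ₀ : 0 ≤ δ := (abs_nonneg _).trans hb
    have hρ₀ : 0 ≤ ρ := by
      refine le_trans ?_ (hρ N hKN)
      have : 0 ≤ ∫ ω, (X N ω : ℝ) ^ 2 ∂μ := integral_nonneg fun _ => sq_nonneg _
      positivity
    have hstep' : 9 * |b| ^ 3 + b ^ 2 / 2 * ((∫ ω, (X N ω : ℝ) ^ 2 ∂μ) / N ^ 2 + |1 - d|)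
        ≤ (18 * δ + ρ) * (b ^ 2 * d) := by
      have h₁ : |b| ^ 3 ≤ b ^ 2 * δ := by
        rw [pow_succ, sq_abs]; gcongr
      have h₂ : b ^ 2 / 2 * ((∫ ω, (X N ω : ℝ) ^ 2 ∂μ) / N ^ 2 + |1 - d|) ≤ b ^ 2 / 2 * ρ := by
        gcongr
        exact hρ N hKN
      have h₃ : (18 * δ + ρ) * (b ^ 2 * (1 / 2)) ≤ (18 * δ + ρ) * (b ^ 2 * d) := by gcongr
      linarith
    have hexp : Real.exp (-((b ^ 2 * w (N + 1) - A) / 2))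
        = Real.exp (-(b ^ 2 * d / 2)) * Real.exp (-((a ^ 2 * w N - A) / 2)) := by
      rw [← Real.exp_add, hbd]; ring_nf
    have hle : ‖((Real.exp (-(b ^ 2 * d / 2)) : ℝ) : ℂ)‖ ≤ 1 := by
      rw [Complex.norm_real, Real.norm_eq_abs, Real.abs_exp, Real.exp_le_one_iff]
      have : 0 ≤ b ^ 2 * d := mul_nonneg (sq_nonneg b) (by linarith)
      linarith
    have split : charFun (μ.map fun ω => (X (N + 1) ω : ℝ)) b
          - (Real.exp (-((b ^ 2 * w (N + 1) - A) / 2)) : ℝ) * Φ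
        = (charFun (μ.map fun ω => (X (N + 1) ω : ℝ)) b
            - (Real.exp (-(b ^ 2 * d / 2)) : ℝ) * charFun (μ.map fun ω => (X N ω : ℝ)) a)
          + (Real.exp (-(b ^ 2 * d / 2)) : ℝ) * (charFun (μ.map fun ω => (X N ω : ℝ)) a
            - (Real.exp (-((a ^ 2 * w N - A) / 2)) : ℝ) * Φ) := by
      rw [hexp]; push_cast; ring
    rw [split]
    calc _ ≤ _ := norm_add_le _ _
      _ ≤ (18 * δ + ρ) * (b ^ 2 * d) + 1 * ((18 * δ + ρ) * (a ^ 2 * w N - A)) := by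
          rw [norm_mul]
          gcongr
          exact hstep.trans hstep'
      _ = _ := by rw [hbd]; ring

lemma tendsto_integral_walk_sq_div_sq (h : IsElephantRandomWalk μ p q X η m ε)
    (hp : p ≤ 3 / 4) :
    Tendsto (fun n : ℕ => (∫ ω, (X n ω : ℝ) ^ 2 ∂μ) / (n : ℝ) ^ 2) atTop (nhds 0) := by
  have hlim : Tendsto (fun n : ℕ => ((n : ℝ)⁻¹ + Real.log n / n)) atTop (nhds 0) := by
    have h₁ := tendsto_inv_atTop_nhds_zero_nat (𝕜 := ℝ)
    have h₂ := (Real.isLittleO_log_id_atTop.tendsto_div_nhds_zero).comp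
      (tendsto_natCast_atTop_atTop (R := ℝ))
    simpa using h₁.add h₂
  refine tendsto_of_tendsto_of_tendsto_of_le_of_le' tendsto_const_nhds hlim
    (.of_forall fun n => ?_) ?_
  · have : 0 ≤ ∫ ω, (X n ω : ℝ) ^ 2 ∂μ := integral_nonneg fun _ => sq_nonneg _
    positivity
  · filter_upwards [eventually_ge_atTop 1] with n hn
    have hn' : (0 : ℝ) < n := by exact_mod_cast hn
    rw [div_le_iff₀ (by positivity)]
    refine (h.integral_walk_sq_le hp hn).trans_eq ?_
    field_simp

/-- If `w` solves the variance recursion `w (k + 1) = (1 + (2 * p - 1) / k) ^ 2 * w k + 1`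
asymptotically, and no single step contributes to it in the limit, then `X n / √(w n)` is
asymptotically standard normal. -/
lemma tendsto_charFun_walk (h : IsElephantRandomWalk μ p q X η m ε)
    (hp : p ∈ Set.Icc (0 : ℝ) 1) (hp' : p ≤ 3 / 4) {w : ℕ → ℝ} {β : ℝ}
    (hβ : 0 ≤ β) (hpβ : 2 * p - 1 ≤ β) (hw : ∀ᶠ n in atTop, 0 < w n)
    (hrec : Tendsto (fun k : ℕ => w (k + 1) - (1 + (2 * p - 1) / k) ^ 2 * w k) atTop (nhds 1))
    (hgrow : Tendsto (fun n : ℕ => (n : ℝ) ^ β / √(w n)) atTop (nhds 0)) (t : ℝ) :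
    Tendsto (fun n => charFun (μ.map fun ω => (X n ω : ℝ)) (t / √(w n))) atTop
      (nhds (Real.exp (-(t ^ 2 / 2)) : ℝ)) := by
  -- `a n` bounds all the frequencies that occur in going back from time `n`
  set a : ℕ → ℝ := fun n => |t| * Real.exp β * ((n : ℝ) ^ β / √(w n)) with ha
  have ha₀ : Tendsto a atTop (nhds 0) := by simpa using hgrow.const_mul (|t| * Real.exp β)
  have hfreq : ∀ k n, 1 ≤ k → k ≤ n → |meanGrowth (2 * p - 1) k n * (t / √(w n))| ≤ a n := by
    intro k n hk hkn
    rw [abs_mul, abs_div, abs_of_nonneg (Real.sqrt_nonneg _)]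
    calc _ ≤ Real.exp β * (n : ℝ) ^ β * (|t| / √(w n)) := by
          gcongr
          exact abs_meanGrowth_le (by linarith [hp.1]) hpβ hβ hk hkn
      _ = a n := by rw [ha]; ring
  rw [Metric.tendsto_atTop']
  intro r hr
  obtain ⟨ρ, hρ₀, hρt⟩ : ∃ ρ : ℝ, 0 < ρ ∧ ρ * t ^ 2 < r / 2 := by
    refine ⟨r / (2 * (t ^ 2 + 1)), by positivity, ?_⟩
    rw [div_mul_eq_mul_div, div_lt_iff₀ (by positivity)]
    nlinarith [sq_nonneg t]
  have hρ := (h.tendsto_integral_walk_sq_div_sq hp').add (hrec.const_sub 1).abs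
  simp only [sub_self, abs_zero, add_zero] at hρ
  obtain ⟨K, hKall⟩ := eventually_atTop.1 ((eventually_ge_atTop 1).and (hw.and
    ((hrec.eventually_const_le (show (1 / 2 : ℝ) < 1 by norm_num)).and
      ((hrec.eventually_le_const (show (1 : ℝ) < 2 by norm_num)).and
        (hρ.eventually_le_const hρ₀)))))
  have hK : 1 ≤ K := (hKall K le_rfl).1
  have hCK : Tendsto (fun n => meanGrowth (2 * p - 1) K n * (t / √(w n))) atTop (nhds 0) := by
    refine squeeze_zero_norm' ?_ ha₀
    filter_upwards [eventually_ge_atTop K] with n hn using hfreq K n hK hn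
  have hΦ : Tendsto (fun n => charFun (μ.map fun ω => (X K ω : ℝ))
      (meanGrowth (2 * p - 1) K n * (t / √(w n)))) atTop (nhds 1) := by
    rw [tendsto_iff_norm_sub_tendsto_zero]
    refine squeeze_zero (fun _ => norm_nonneg _) (fun n => h.norm_charFun_walk_sub_one_le K _) ?_
    simpa using hCK.abs.mul_const (K : ℝ)
  have hE : Tendsto (fun n => ((Real.exp (-((t ^ 2
      - (meanGrowth (2 * p - 1) K n * (t / √(w n))) ^ 2 * w K) / 2)) : ℝ) : ℂ)) atTop
      (nhds (Real.exp (-(t ^ 2 / 2)) : ℝ)) := by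
    have := ((((hCK.pow 2).mul_const (w K)).const_sub (t ^ 2)).div_const 2).neg
    simp only [ne_eq, OfNat.ofNat_ne_zero, not_false_eq_true, zero_pow, zero_mul,
      sub_zero] at this
    exact (Complex.continuous_ofReal.tendsto _).comp ((Real.continuous_exp.tendsto _).comp this)
  have hrest : Tendsto (fun n => 18 * a n * t ^ 2 + ‖((Real.exp (-((t ^ 2
      - (meanGrowth (2 * p - 1) K n * (t / √(w n))) ^ 2 * w K) / 2)) : ℝ) : ℂ)
        * charFun (μ.map fun ω => (X K ω : ℝ)) (meanGrowth (2 * p - 1) K n * (t / √(w n)))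
        - (Real.exp (-(t ^ 2 / 2)) : ℝ)‖) atTop (nhds 0) := by
    have h₁ : Tendsto (fun n => 18 * a n * t ^ 2) atTop (nhds 0) := by
      simpa using (ha₀.const_mul 18).mul_const (t ^ 2)
    have h₂ := tendsto_iff_norm_sub_tendsto_zero.1 (hE.mul hΦ)
    simpa using h₁.add h₂
  obtain ⟨N, hN⟩ := eventually_atTop.1 ((eventually_ge_atTop K).and
    ((ha₀.eventually_le_const (show (0 : ℝ) < 1 / 2 by norm_num)).and
      (hrest.eventually_lt_const (half_pos hr))))
  refine ⟨N, fun n hn => ?_⟩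
  obtain ⟨hKn, han, hsmall⟩ := hN n hn.le
  have key := h.norm_charFun_walk_sub_exp_mul_le hp w hK (n := n) (c := t / √(w n)) (ρ := ρ) han
    (fun k hk hkn => hfreq k n (hK.trans hk) hkn) (fun k hk => (hKall k hk).2.2.1)
    (fun k hk => (hKall k hk).2.2.2.1) (fun k hk => (hKall k hk).2.2.2.2) hKn le_rfl
  have hwn := (hKall n hKn).2.1
  have hwK := (hKall K le_rfl).2.1
  have hsq : (t / √(w n)) ^ 2 * w n = t ^ 2 := by
    rw [div_pow, Real.sq_sqrt hwn.le]; field_simp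
  rw [meanGrowth_self, one_mul, hsq] at key
  rw [dist_eq_norm]
  have ha_nonneg : 0 ≤ a n := (abs_nonneg _).trans (hfreq K n hK hKn)
  have hA : 0 ≤ (meanGrowth (2 * p - 1) K n * (t / √(w n))) ^ 2 * w K := by positivity
  have key' : (18 * a n + ρ)
      * (t ^ 2 - (meanGrowth (2 * p - 1) K n * (t / √(w n))) ^ 2 * w K)
      ≤ (18 * a n + ρ) * t ^ 2 := by
    gcongr
    linarith
  have tri := norm_sub_le_norm_sub_add_norm_sub
    (charFun (μ.map fun ω => (X n ω : ℝ)) (t / √(w n)))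
    (((Real.exp (-((t ^ 2 - (meanGrowth (2 * p - 1) K n * (t / √(w n))) ^ 2 * w K) / 2)) : ℝ) : ℂ)
      * charFun (μ.map fun ω => (X K ω : ℝ)) (meanGrowth (2 * p - 1) K n * (t / √(w n))))
    ((Real.exp (-(t ^ 2 / 2)) : ℝ) : ℂ)
  linarith

/-- The corresponding convergence in distribution, with a negligible deterministic centering. -/
lemma tendstoInDistribution_walk (h : IsElephantRandomWalk μ p q X η m ε)
    (hp : p ∈ Set.Icc (0 : ℝ) 1) (hp' : p ≤ 3 / 4) {w : ℕ → ℝ} {β : ℝ}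
    (hβ : 0 ≤ β) (hpβ : 2 * p - 1 ≤ β) (hw : ∀ᶠ n in atTop, 0 < w n)
    (hrec : Tendsto (fun k : ℕ => w (k + 1) - (1 + (2 * p - 1) / k) ^ 2 * w k) atTop (nhds 1))
    (hgrow : Tendsto (fun n : ℕ => (n : ℝ) ^ β / √(w n)) atTop (nhds 0)) {b : ℕ → ℝ}
    (hb : Tendsto (fun n => b n / √(w n)) atTop (nhds 0)) :
    TendstoInDistribution (fun (n : ℕ) (ω : Ω) => ((X n ω : ℝ) - b n) / √(w n))
      atTop (id : ℝ → ℝ) (fun _ => μ) (gaussianReal 0 1) := by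
  have hmX : ∀ n, AEMeasurable (fun ω => (X n ω : ℝ)) μ := fun n =>
    ((measurable_of_countable fun z : ℤ => (z : ℝ)).comp (h.measurable_walk n)).aemeasurable
  have hm : ∀ n, AEMeasurable (fun ω => ((X n ω : ℝ) - b n) / √(w n)) μ := fun n =>
    ((hmX n).sub_const _).div_const _
  refine ⟨hm, aemeasurable_id, ?_⟩
  refine ProbabilityMeasure.tendsto_iff_tendsto_charFun.2 fun t => ?_
  simp only [ProbabilityMeasure.coe_mk, Measure.map_id, charFun_gaussianReal]
  have e : ∀ n, charFun (μ.map fun ω => ((X n ω : ℝ) - b n) / √(w n)) t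
      = Complex.exp ((-(t * (b n / √(w n))) : ℝ) * Complex.I)
        * charFun (μ.map fun ω => (X n ω : ℝ)) (t / √(w n)) := by
    intro n
    rw [h.charFun_walk, charFun_apply_real, integral_map (hm n) (by fun_prop),
      ← integral_const_mul]
    refine integral_congr_ae (.of_forall fun ω => ?_)
    simp only
    rw [← Complex.exp_add]
    congr 1
    push_cast
    ring
  simp_rw [e]
  have h₁ : Tendsto (fun n => Complex.exp ((-(t * (b n / √(w n))) : ℝ) * Complex.I)) atTop
      (nhds 1) := by
    have hc : Continuous fun x : ℝ => Complex.exp ((-(t * x) : ℝ) * Complex.I) := by fun_prop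
    simpa [Function.comp_def] using (hc.tendsto 0).comp hb
  have := h₁.mul (h.tendsto_charFun_walk hp hp' hβ hpβ hw hrec hgrow t)
  convert this using 2
  push_cast
  rw [one_mul]
  simp

end IsElephantRandomWalk

/-! ### The norming sequences -/

/-- For `α < 1 / 2` the linear sequence `k / (1 - 2 * α)` is an asymptotic solution of the variance
recursion. -/
lemma tendsto_linear_norming_recursion {α : ℝ} (hα : α < 1 / 2) :
    Tendsto (fun k : ℕ => ((k + 1 : ℕ) : ℝ) / (1 - 2 * α)
      - (1 + α / k) ^ 2 * ((k : ℝ) / (1 - 2 * α))) atTop (nhds 1) := by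
  have hα' : 1 - 2 * α ≠ 0 := by linarith
  have hlim : Tendsto (fun k : ℕ => 1 - α ^ 2 / (1 - 2 * α) * (k : ℝ)⁻¹) atTop (nhds 1) := by
    simpa using ((tendsto_inv_atTop_nhds_zero_nat (𝕜 := ℝ)).const_mul
      (α ^ 2 / (1 - 2 * α))).const_sub 1
  refine hlim.congr' ?_
  filter_upwards [eventually_ge_atTop 1] with k hk
  have hk' : (k : ℝ) ≠ 0 := by positivity
  obtain ⟨a, rfl⟩ : ∃ a, α = (1 - a) / 2 := ⟨1 - 2 * α, by ring⟩
  rw [show 1 - 2 * ((1 - a) / 2) = a by ring] at hα' ⊢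
  push_cast
  field_simp
  ring

/-- At `α = 1 / 2` the sequence `k * log k` is an asymptotic solution of the variance recursion. -/
lemma tendsto_mul_log_norming_recursion :
    Tendsto (fun k : ℕ => ((k + 1 : ℕ) : ℝ) * Real.log (k + 1 : ℕ)
      - (1 + 1 / 2 / k) ^ 2 * ((k : ℝ) * Real.log k)) atTop (nhds 1) := by
  have h₁ : Tendsto (fun k : ℕ => (k : ℝ) * Real.log (1 + 1 / k)) atTop (nhds 1) :=
    (Real.tendsto_mul_log_one_add_div_atTop 1).comp tendsto_natCast_atTop_atTop
  have h₂ : Tendsto (fun k : ℕ => (k : ℝ)⁻¹) atTop (nhds 0) := tendsto_inv_atTop_nhds_zero_nat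
  have h₃ : Tendsto (fun k : ℕ => Real.log k / k) atTop (nhds 0) :=
    (Real.isLittleO_log_id_atTop.tendsto_div_nhds_zero).comp tendsto_natCast_atTop_atTop
  have hlim : Tendsto (fun k : ℕ => (k : ℝ) * Real.log (1 + 1 / k) * (1 + (k : ℝ)⁻¹)
      - 1 / 4 * (Real.log k / k)) atTop (nhds 1) := by
    have := (h₁.mul (h₂.const_add 1)).sub (h₃.const_mul (1 / 4))
    rwa [add_zero, one_mul, mul_zero, sub_zero] at this
  refine hlim.congr' ?_
  filter_upwards [eventually_ge_atTop 1] with k hk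
  have hk' : (0 : ℝ) < k := by exact_mod_cast hk
  have hlog : Real.log (k + 1 : ℕ) = Real.log k + Real.log (1 + 1 / k) := by
    rw [← Real.log_mul (by positivity) (by positivity)]
    congr 1; push_cast; field_simp
  rw [hlog]
  push_cast
  field_simp
  ring

lemma tendsto_rpow_div_sqrt_div {β : ℝ} (hβ : β < 1 / 2) {a : ℝ} (ha : 0 < a) :
    Tendsto (fun n : ℕ => (n : ℝ) ^ β / √((n : ℝ) / a)) atTop (nhds 0) := by
  have hlim : Tendsto (fun n : ℕ => √a * (n : ℝ) ^ (-(1 / 2 - β))) atTop (nhds 0) := by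
    simpa using ((tendsto_rpow_neg_atTop (show 0 < 1 / 2 - β by linarith)).comp
      tendsto_natCast_atTop_atTop).const_mul (√a)
  refine hlim.congr' ?_
  filter_upwards [eventually_ge_atTop 1] with n hn
  have hn' : (0 : ℝ) < n := by exact_mod_cast hn
  have hsa : √a ≠ 0 := (Real.sqrt_pos.2 ha).ne'
  rw [Real.sqrt_div hn'.le, show -(1 / 2 - β) = β - 1 / 2 by ring, Real.rpow_sub hn',
    ← Real.sqrt_eq_rpow]
  field_simp

lemma tendsto_sqrt_div_sqrt_mul_log :
    Tendsto (fun n : ℕ => (n : ℝ) ^ (1 / 2 : ℝ) / √((n : ℝ) * Real.log n)) atTop (nhds 0) := by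
  have hlim : Tendsto (fun n : ℕ => (√(Real.log n))⁻¹) atTop (nhds 0) :=
    tendsto_inv_atTop_zero.comp (Real.tendsto_sqrt_atTop.comp
      (Real.tendsto_log_atTop.comp tendsto_natCast_atTop_atTop))
  refine hlim.congr' ?_
  filter_upwards [eventually_ge_atTop 1] with n hn
  have hn' : (0 : ℝ) < n := by exact_mod_cast hn
  have hs : √(n : ℝ) ≠ 0 := (Real.sqrt_pos.2 hn').ne'
  rw [Real.sqrt_mul hn'.le, ← Real.sqrt_eq_rpow]
  field_simp

/-! ### The elephant random walk -/

theorem theorem2 {Ω : Type*} [MeasurableSpace Ω] (μ : Measure Ω) [IsProbabilityMeasure μ]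
    (p q : ℝ) (hp : p ∈ Set.Icc (0 : ℝ) 1) (hq : q ∈ Set.Icc (0 : ℝ) 1)
    (X η : ℕ → Ω → ℤ) (m : ℕ → Ω → ℕ) (ε : ℕ → Ω → ℤ)
    (hX : IsElephantRandomWalk μ p q X η m ε) :
    (p < 3 / 4 →
      TendstoInDistribution
        (fun (n : ℕ) (ω : Ω) =>
          ((X n ω : ℝ) - (2 * q - 1) / Real.Gamma (2 * p) * (n : ℝ) ^ (2 * p - 1))
            / Real.sqrt ((n : ℝ) / (3 - 4 * p)))
        atTop (id : ℝ → ℝ) (fun _ => μ) (gaussianReal 0 1)) ∧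
    (p = 3 / 4 →
      TendstoInDistribution
        (fun (n : ℕ) (ω : Ω) =>
          ((X n ω : ℝ) - (2 * q - 1) / Real.Gamma (3 / 2) * (n : ℝ) ^ (1 / 2 : ℝ))
            / Real.sqrt ((n : ℝ) * Real.log (n : ℝ)))
        atTop (id : ℝ → ℝ) (fun _ => μ) (gaussianReal 0 1)) := by
  refine ⟨fun hlt => ?_, fun heq => ?_⟩
  · have hpos : 0 < 3 - 4 * p := by linarith
    have hrec := tendsto_linear_norming_recursion (α := 2 * p - 1) (by linarith)
    rw [show 1 - 2 * (2 * p - 1) = 3 - 4 * p by ring] at hrec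
    refine hX.tendstoInDistribution_walk hp hlt.le (w := fun n => (n : ℝ) / (3 - 4 * p))
      (b := fun n => (2 * q - 1) / Real.Gamma (2 * p) * (n : ℝ) ^ (2 * p - 1))
      (le_max_right (2 * p - 1) 0) (le_max_left _ _) ?_ hrec
      (tendsto_rpow_div_sqrt_div (max_lt (by linarith) (by norm_num)) hpos) ?_
    · filter_upwards [eventually_ge_atTop 1] with n hn
      have hn' : (0 : ℝ) < n := by exact_mod_cast hn
      positivity
    · -- The centering has smaller order than the norming. Only its coefficient depends on the
      -- Gamma function, so that the junk value of `1 / Real.Gamma 0` at `p = 0` is harmless.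
      simpa [mul_div_assoc] using (tendsto_rpow_div_sqrt_div (β := 2 * p - 1) (by linarith)
        hpos).const_mul ((2 * q - 1) / Real.Gamma (2 * p))
  · have hα : 2 * p - 1 = 1 / 2 := by rw [heq]; norm_num
    have hrec := tendsto_mul_log_norming_recursion
    rw [← hα] at hrec
    refine hX.tendstoInDistribution_walk hp heq.le (w := fun n => (n : ℝ) * Real.log n)
      (b := fun n => (2 * q - 1) / Real.Gamma (3 / 2) * (n : ℝ) ^ (1 / 2 : ℝ))
      (β := 1 / 2) (by norm_num) hα.le ?_ hrec tendsto_sqrt_div_sqrt_mul_log ?_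
    · filter_upwards [eventually_ge_atTop 2] with n hn
      have hn' : (1 : ℝ) < n := by exact_mod_cast hn
      exact mul_pos (by linarith) (Real.log_pos hn')
    · simpa [mul_div_assoc] using
        tendsto_sqrt_div_sqrt_mul_log.const_mul ((2 * q - 1) / Real.Gamma (3 / 2))
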